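/- **Setting.** Let $\mathcal Z\subset\mathbb R^N$ be a convex body (compact, convex, non-empty interior), let $\|\cdot\|$ be any norm on $\mathbb R^N$, let $j:[0,\infty)\to[0,\infty)$ be a homeomorphism with $j(0)=0$, and put $\delta(x,y)=j(\|x-y\|)$ (the metric induced by the norm if $j=\mathrm{id}$, a semi-metric in general). Let $\lambda,\tau>0$. For $z,\tilde z\in\mathcal Z$ let $$p(\tilde z\mid z)=\frac{e^{-\lambda\,\delta(\tilde z,z)}}{\int_{\mathcal Z}e^{-\lambda\,\delta(z,w)}\,dw},\qquad q_h(\tilde z\mid z)=\frac{e^{-\delta(h(\tilde z),h(z))/\tau}}{\int_{\mathcal Z}e^{-\delta(h(w),h(z))/\tau}\,dw}\quad(h:\mathcal Z\to\mathcal Z),$$ and let the cross-entropy between $p$ and $q_h$ be $$\mathcal L(h)=\frac1{|\mathcal Z|}\int_{\mathcal Z}\int_{\mathcal Z}p(\tilde z\mid z)\,\bigl(-\log q_h(\tilde z\mid z)\bigr)\,d\tilde z\,dz .$$ Let $\mathcal X\subseteq\mathbb R^K$, let $g:\mathcal Z\to\mathcal X$ be differentiable and injective, let $f:\mathcal X\to\mathcal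 Z$ be differentiable, and put $h=f\circ g$. (Differentiability on a set means differentiability within that set.) **Theorem.** 1. Suppose $\lambda\tau=1$ (so that $p$ and $q_h$ have the same form with the same scale). If $f$ minimizes $f'\mapsto\mathcal L(f'\circ g)$ among all differentiable maps $f':\mathcal X\to\mathcal Z$, then $h=f\circ g$ is the restriction to $\mathcal Z$ of an invertible affine map of $\mathbb R^N$. 2. For arbitrary $\lambda,\tau>0$, let $\mathcal F$ be any class of measurable maps $\mathcal X\to\mathcal Z$ that contains $f$ and is flexible enough for $q$ to match $p$, i.e. there is $f_0\in\mathcal F$ with $q_{f_0\circ g}(\tilde z\mid z)=p(\tilde z\mid z)$ for all $z,\tilde z\in\mathcal Z$. If $f$ minimizes $f'\mapsto\mathcal L(f'\circ g)$ over $\mathcal F$, then $h=f\circ g$ is the restriction to $\mathcal Z$ of an invertible affine map of $\mathbb R^N$. -/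

import Mathlib

open Real Set MeasureTheory
open scoped NNReal

/-- The distance `δ(x, y) = j (ν (x - y))`, where `ν` is a norm on `ℝ^N` (a seminorm that is assumed
definite in the theorem) and `j` is a homeomorphism of `[0, ∞)`. It is the metric induced by `ν` if
`j = id`, and in general a semi-metric. -/
noncomputable def normDist {N : ℕ} (ν : Seminorm ℝ (EuclideanSpace ℝ (Fin N))) (j : ℝ≥0 ≃ₜ ℝ≥0)
    (x y : EuclideanSpace ℝ (Fin N)) : ℝ :=
  (j (Real.toNNReal (ν (x - y))) : ℝ)

/-- The ground-truth conditional density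
`p(z' | z) = exp (-lam δ(z', z)) / C_p(z)`, `C_p(z) = ∫_Z exp (-lam δ(z, w)) dw`. -/
noncomputable def trueDensity {N : ℕ} (Z : Set (EuclideanSpace ℝ (Fin N)))
    (δ : EuclideanSpace ℝ (Fin N) → EuclideanSpace ℝ (Fin N) → ℝ) (lam : ℝ)
    (z' z : EuclideanSpace ℝ (Fin N)) : ℝ :=
  (∫ w in Z, exp (-(lam * δ z w)))⁻¹ * exp (-(lam * δ z' z))

/-- The model conditional density
`q_h(z' | z) = exp (-δ(h z', h z) / tau) / C_q(z)`, `C_q(z) = ∫_Z exp (-δ(h w, h z) / tau) dw`. -/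
noncomputable def modelDensity {N : ℕ} (Z : Set (EuclideanSpace ℝ (Fin N)))
    (δ : EuclideanSpace ℝ (Fin N) → EuclideanSpace ℝ (Fin N) → ℝ) (tau : ℝ)
    (h : EuclideanSpace ℝ (Fin N) → EuclideanSpace ℝ (Fin N))
    (z' z : EuclideanSpace ℝ (Fin N)) : ℝ :=
  (∫ w in Z, exp (-(δ (h w) (h z) / tau)))⁻¹ * exp (-(δ (h z') (h z) / tau))

/-- The cross-entropy `E_{z ~ Unif(Z)} E_{z' ~ p(· | z)} [-log q_h(z' | z)]`. -/
noncomputable def crossEntropy {N : ℕ} (Z : Set (EuclideanSpace ℝ (Fin N)))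
    (δ : EuclideanSpace ℝ (Fin N) → EuclideanSpace ℝ (Fin N) → ℝ) (lam tau : ℝ)
    (h : EuclideanSpace ℝ (Fin N) → EuclideanSpace ℝ (Fin N)) : ℝ :=
  ⨍ z in Z, ∫ z' in Z, trueDensity Z δ lam z' z * (-log (modelDensity Z δ tau h z' z))

/-- The measurable encoders `X → Z` (values outside `X` are irrelevant). -/
def encoders {K N : ℕ} (X : Set (EuclideanSpace ℝ (Fin K))) (Z : Set (EuclideanSpace ℝ (Fin N))) :
    Set (EuclideanSpace ℝ (Fin K) → EuclideanSpace ℝ (Fin N)) :=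
  {f | MapsTo f X Z ∧ Measurable (X.domRestrict f)}

/-- The differentiable encoders `X → Z`. -/
def diffEncoders {K N : ℕ} (X : Set (EuclideanSpace ℝ (Fin K)))
    (Z : Set (EuclideanSpace ℝ (Fin N))) :
    Set (EuclideanSpace ℝ (Fin K) → EuclideanSpace ℝ (Fin N)) :=
  {f | MapsTo f X Z ∧ DifferentiableOn ℝ f X}

/-! Write `p` as the model density of the identity at temperature `lam⁻¹`. Gibbs' inequality makes
the entropy of `p` a lower bound for the cross-entropy, with equality only if `q_h = p` on all of `Z
×ˢ Z`, by continuity. Hence everything follows once the cross-entropy of `f ∘ g` is at most that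
entropy. In part 2 the matching encoder attains it. In part 1 the inverse of `g` would attain it but
need not be differentiable, so it is approximated uniformly by smooth maps into `Z`
(`exists_differentiable_approx_inverse`), along which the cross-entropy tends to the entropy.

Equal densities give `δ (h x) (h y) = lam * tau * δ x y`, so `ν (h x - h y)` is a strictly
increasing function `φ` of `ν (x - y)`. Such an `h` has injective derivatives, so it is open on the
interior. A local Mazur–Ulam argument shows that it preserves midpoints of nearby points, and with
differentiability this makes it locally affine, then affine on `Z`. -/

open Filter Topology

/-! ### Reflections, openness and preservation of midpoints -/

/-- Väisälä's reflection argument: a distance-preserving permutation of a bounded space which fixes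
two points also fixes every center of a symmetry of the space that exchanges them. -/
theorem fixed_center_of_preserves {W : Type*} (d : W → W → ℝ) (C : ℝ) (hC : ∀ x y, d x y ≤ C)
    (hd0 : ∀ x y, 0 ≤ d x y) (hd : ∀ x y, d x y = 0 → x = y)
    (R : Equiv.Perm W) (hR : ∀ x y, d (R x) (R y) = d x y) {a b m : W}
    (hab : R a = b) (hba : R b = a) (hm : R m = m) (hRm : ∀ x, d (R x) x = 2 * d x m)
    (e : Equiv.Perm W) (he : ∀ x y, d (e x) (e y) = d x y) (hea : e a = a) (heb : e b = b) :
    e m = m := by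
  have key : ∀ n : ℕ, ∀ e : Equiv.Perm W, (∀ x y, d (e x) (e y) = d x y) → e a = a → e b = b →
      2 ^ n * d (e m) m ≤ C := by
    intro n
    induction n with
    | zero => intro e _ _ _; simpa using hC (e m) m
    | succ n ih =>
      intro e he hea heb
      have hesymm : ∀ x y, d (e.symm x) (e.symm y) = d x y := fun x y => by
        rw [← he (e.symm x), e.apply_symm_apply, e.apply_symm_apply]
      have hsa : e.symm a = a := e.symm_apply_eq.2 hea.symm
      have hsb : e.symm b = b := e.symm_apply_eq.2 heb.symm
      -- `R e⁻¹ R e` preserves `d`, fixes `a` and `b`, and moves `m` twice as far as `e` does.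
      -- Iterating would make the displacement exceed the bound `C`.
      have h1 := ih (((e.trans R).trans e.symm).trans R)
        (fun x y => by simp [hR, he, hesymm])
        (by simp [hea, hab, hsb, hba])
        (by simp [heb, hba, hsa, hab])
      have h2 : d ((((e.trans R).trans e.symm).trans R) m) m = 2 * d (e m) m := by
        rw [← hRm (e m)]
        calc d (R (e.symm (R (e m)))) m = d (R (e.symm (R (e m)))) (R m) := by rw [hm]
          _ = d (R (e m)) (e m) := by rw [hR, ← he, e.apply_symm_apply]
      rw [h2] at h1
      rw [pow_succ]; linarith
  refine hd _ _ (le_antisymm ?_ (hd0 _ _))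
  by_contra! hpos
  obtain ⟨n, hn⟩ := pow_unbounded_of_one_lt (C / d (e m) m) (one_lt_two)
  rw [div_lt_iff₀ hpos] at hn
  exact absurd (key n e he hea heb) (not_le.2 hn)

section Geometry

variable {E : Type*} [NormedAddCommGroup E] [InnerProductSpace ℝ E] [FiniteDimensional ℝ E]

/-- An injective map whose derivative is everywhere surjective is open, without continuity of the
derivative: minimise `‖h w - y‖ ^ 2` over a closed ball. -/
theorem image_mem_nhds_of_injOn_of_hasFDerivAt {U : Set E} (hU : IsOpen U) {h : E → E}
    {h' : E → E →L[ℝ] E} (hh : ∀ w ∈ U, HasFDerivAt h (h' w) w)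
    (hsurj : ∀ w ∈ U, Function.Surjective (h' w)) (hinj : InjOn h U) {x : E} (hx : x ∈ U) :
    h '' U ∈ 𝓝 (h x) := by
  obtain ⟨r, hr, hrU⟩ := Metric.nhds_basis_closedBall.mem_iff.1 (hU.mem_nhds hx)
  have hcont : ContinuousOn h (Metric.closedBall x r) := fun w hw =>
    (hh w (hrU hw)).continuousAt.continuousWithinAt
  obtain ⟨c, hc, hcs⟩ : ∃ c > 0, ∀ w ∈ Metric.sphere x r, c ≤ ‖h w - h x‖ := by
    rcases (Metric.sphere x r).eq_empty_or_nonempty with he | hne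
    · exact ⟨1, one_pos, by simp [he]⟩
    · obtain ⟨w₀, hw₀, hmin⟩ := (isCompact_sphere x r).exists_isMinOn hne
        (f := fun w => ‖h w - h x‖)
        ((hcont.mono Metric.sphere_subset_closedBall).sub continuousOn_const).norm
      refine ⟨‖h w₀ - h x‖, ?_, fun w hw => hmin hw⟩
      rw [gt_iff_lt, norm_pos_iff, sub_ne_zero]
      intro heq
      have := hinj (hrU (Metric.sphere_subset_closedBall hw₀)) hx heq
      rw [this] at hw₀
      simp at hw₀
      exact hr.ne hw₀
  filter_upwards [Metric.ball_mem_nhds (h x) (half_pos hc)] with y hy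
  obtain ⟨w, hw, hmin⟩ := (isCompact_closedBall x r).exists_isMinOn
    ⟨x, Metric.mem_closedBall_self hr.le⟩ (f := fun w => ‖h w - y‖ ^ 2)
    ((hcont.sub continuousOn_const).norm.pow 2)
  rw [Metric.mem_ball, dist_eq_norm] at hy
  have hwx : ‖h w - y‖ ≤ ‖h x - y‖ := by
    have := hmin (Metric.mem_closedBall_self hr.le)
    exact (pow_le_pow_iff_left₀ (norm_nonneg _) (norm_nonneg _) two_ne_zero).1 this
  -- On the sphere `h` stays at distance at least `c` from `h x`, hence more than `c / 2` from `y`,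
  -- while the centre does better.
  have hwball : w ∈ Metric.ball x r := by
    rcases (Metric.mem_closedBall.1 hw).lt_or_eq with hlt | heq
    · exact hlt
    · have h1 := hcs w heq
      have h2 : ‖h w - h x‖ ≤ ‖h w - y‖ + ‖y - h x‖ := norm_sub_le_norm_sub_add_norm_sub _ _ _
      rw [norm_sub_rev (h x)] at hwx
      linarith
  have hloc : IsLocalMin (fun w => ‖h w - y‖ ^ 2) w :=
    hmin.isLocalMin (mem_of_superset (Metric.isOpen_ball.mem_nhds hwball)
      Metric.ball_subset_closedBall)
  have hder := ((hh w (hrU hw)).sub_const y).norm_sq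
  have hzero := hloc.hasFDerivAt_eq_zero hder
  -- In a direction `v` mapped to `h w - y`, the vanishing derivative is `2 * ‖h w - y‖ ^ 2`.
  obtain ⟨v, hv⟩ := hsurj w (hrU hw) (h w - y)
  have := congrArg (fun L => L v) hzero
  simp only [_root_.smul_apply, ContinuousLinearMap.comp_apply, hv,
    innerSL_apply_apply, _root_.zero_apply, smul_eq_zero, inner_self_eq_zero,
    two_ne_zero, false_or] at this
  exact ⟨w, hrU hw, sub_eq_zero.1 this⟩

variable {ν : Seminorm ℝ E} {φ : ℝ → ℝ} {h : E → E}

-- Mazur–Ulam on the lens `W` of points within `r` of both `a` and `b`. Conjugating by `h` the point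
-- reflection that swaps `h a` and `h b` gives a `ν`-preserving involution `T` of `W`. Composed with
-- the reflection swapping `a` and `b`, it fixes both points, hence their midpoint. The two ball
-- hypotheses keep the lens in `U` and its reflected image in `h '' U`.
omit [FiniteDimensional ℝ E] in
theorem map_midpoint_of_seminorm_map_sub {U : Set E} (hν : ∀ x, ν x = 0 → x = 0)
    (hφ : StrictMonoOn φ (Ici 0)) (hφ0 : φ 0 = 0)
    (hh : ∀ x ∈ U, ∀ y ∈ U, ν (h x - h y) = φ (ν (x - y))) {a b : E} {r : ℝ} (hr : ν (b - a) ≤ r)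
    (hW : ∀ x, ν (x - a) ≤ r → x ∈ U) (hW' : ∀ y, ν (y - h a) ≤ φ r → y ∈ h '' U) :
    h (midpoint ℝ a b) = midpoint ℝ (h a) (h b) := by
  have hr0 : 0 ≤ r := (apply_nonneg ν _).trans hr
  let W : Set E := {x | ν (x - a) ≤ r ∧ ν (x - b) ≤ r}
  have hWU : ∀ x ∈ W, x ∈ U := fun x hx => hW x hx.1
  have haW : a ∈ W := ⟨by simpa using hr0, by rwa [map_sub_rev]⟩
  have hbW : b ∈ W := ⟨hr, by simpa using hr0⟩
  have hinj : ∀ x ∈ U, ∀ y ∈ U, h x = h y → x = y := by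
    intro x hx y hy hxy
    have := hh x hx y hy
    rw [hxy, sub_self, map_zero, ← hφ0] at this
    exact sub_eq_zero.1 (hν _ (hφ.injOn (mem_Ici.2 le_rfl) (apply_nonneg ν _) this).symm)
  have hRW : ∀ x ∈ W, a + b - x ∈ W := fun x hx =>
    ⟨by rw [show a + b - x - a = -(x - b) by abel, map_neg_eq_map]; exact hx.2,
      by rw [show a + b - x - b = -(x - a) by abel, map_neg_eq_map]; exact hx.1⟩
  have hT : ∀ x : W, ∃ y : W, h y = h a + h b - h x := by
    intro x
    have hxa : ν (h x - h a) ≤ φ r := by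
      rw [hh x (hWU x x.2) a (hWU a haW)]
      exact hφ.monotoneOn (apply_nonneg ν _) hr0 x.2.1
    have hxb : ν (h x - h b) ≤ φ r := by
      rw [hh x (hWU x x.2) b (hWU b hbW)]
      exact hφ.monotoneOn (apply_nonneg ν _) hr0 x.2.2
    obtain ⟨y, hy, hyx⟩ := hW' (h a + h b - h x) (by
      rw [show h a + h b - h x - h a = -(h x - h b) by abel, map_neg_eq_map]; exact hxb)
    refine ⟨⟨y, ?_, ?_⟩, hyx⟩
    · rw [← hφ.le_iff_le (apply_nonneg ν _) hr0, ← hh y hy a (hWU a haW), hyx,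
        show h a + h b - h x - h a = -(h x - h b) by abel, map_neg_eq_map]
      exact hxb
    · rw [← hφ.le_iff_le (apply_nonneg ν _) hr0, ← hh y hy b (hWU b hbW), hyx,
        show h a + h b - h x - h b = -(h x - h a) by abel, map_neg_eq_map]
      exact hxa
  choose T hT using hT
  have hTinv : Function.Involutive T := fun x => Subtype.ext <|
    hinj _ (hWU _ (T (T x)).2) _ (hWU _ x.2) (by rw [hT, hT]; abel)
  have hRinv : Function.Involutive (fun x : W => (⟨a + b - x, hRW x x.2⟩ : W)) := fun x =>
    Subtype.ext (by simp)
  have hmid : a + b - midpoint ℝ a b = midpoint ℝ a b := by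
    rw [sub_eq_iff_eq_add, midpoint_add_self]
  have hmW : midpoint ℝ a b ∈ W := by
    have h2 : ν ((2 : ℝ)⁻¹ • (b - a)) ≤ r := by
      rw [map_smul_eq_mul]; norm_num
      linarith [apply_nonneg ν (b - a)]
    constructor
    · rwa [midpoint_sub_left, invOf_eq_inv]
    · rwa [midpoint_sub_right, invOf_eq_inv, ← neg_sub, smul_neg, map_neg_eq_map]
  have hTd : ∀ x y : W, ν ((T x : E) - T y) = ν ((x : E) - y) := fun x y => by
    refine hφ.injOn (apply_nonneg ν _) (apply_nonneg ν _) ?_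
    rw [← hh _ (hWU _ (T x).2) _ (hWU _ (T y).2), ← hh _ (hWU _ x.2) _ (hWU _ y.2), hT, hT,
      show h a + h b - h x - (h a + h b - h y) = -(h x - h y) by abel, map_neg_eq_map]
  have hTa : T ⟨a, haW⟩ = ⟨b, hbW⟩ := Subtype.ext <|
    hinj _ (hWU _ (T _).2) _ (hWU _ hbW) (by rw [hT]; abel)
  have hTb : T ⟨b, hbW⟩ = ⟨a, haW⟩ := Subtype.ext <|
    hinj _ (hWU _ (T _).2) _ (hWU _ haW) (by rw [hT]; abel)
  have hRd : ∀ x y : W, ν (a + b - (x : E) - (a + b - y)) = ν ((x : E) - y) := fun x y => by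
    rw [show a + b - (x : E) - (a + b - y) = -(x - y) by abel, map_neg_eq_map]
  have hfix := fixed_center_of_preserves (W := W) (fun x y => ν ((x : E) - y)) (r + r)
    (fun x y => by
      have := map_add_le_add ν ((x : E) - a) (a - y)
      rw [sub_add_sub_cancel, map_sub_rev ν a] at this
      exact this.trans (add_le_add x.2.1 y.2.1))
    (fun x y => apply_nonneg ν _) (fun x y hxy => Subtype.ext (sub_eq_zero.1 (hν _ hxy)))
    hRinv.toPerm hRd (a := ⟨a, haW⟩) (b := ⟨b, hbW⟩) (m := ⟨midpoint ℝ a b, hmW⟩)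
    (Subtype.ext (by simp)) (Subtype.ext (by simp)) (Subtype.ext hmid)
    (fun x => by
      have : a + b - (x : E) - x = -((2 : ℝ) • ((x : E) - midpoint ℝ a b)) := by
        rw [smul_sub, two_smul, two_smul, midpoint_add_self]; abel
      simp [this, map_smul_eq_mul])
    (hRinv.toPerm.trans hTinv.toPerm) (fun x y => by
      simp only [Equiv.trans_apply, Function.Involutive.coe_toPerm, hTd, hRd])
    (by simp [hTb]) (by simp [hTa])
  have hTm : T ⟨midpoint ℝ a b, hmW⟩ = ⟨midpoint ℝ a b, hmW⟩ := by
    simpa [hmid] using hfix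
  have h3 := hT ⟨midpoint ℝ a b, hmW⟩
  rw [hTm] at h3
  simp only at h3
  rw [eq_sub_iff_add_eq, ← two_smul ℝ, ← midpoint_add_self (R := ℝ) (h a) (h b),
    ← two_smul ℝ] at h3
  exact smul_right_injective E (two_ne_zero' ℝ) h3

end Geometry

/-! ### From midpoints to affine maps -/

section Geometry

variable {E : Type*} [NormedAddCommGroup E] [InnerProductSpace ℝ E] [FiniteDimensional ℝ E]
variable {ν : Seminorm ℝ E} {φ : ℝ → ℝ} {h : E → E}

variable (ν) in
theorem seminorm_continuous : Continuous ν :=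
  ν.convexOn.locallyLipschitz.continuous

theorem exists_seminorm_ball_subset (hν : ∀ x, ν x = 0 → x = 0) {s : Set E} {x : E}
    (hs : s ∈ 𝓝 x) : ∃ ε > 0, ∀ y, ν (y - x) ≤ ε → y ∈ s := by
  obtain ⟨r, hr, hrs⟩ := Metric.nhds_basis_ball.mem_iff.1 hs
  obtain ⟨c, hc, hcν⟩ : ∃ c > 0, ∀ y ∈ Metric.sphere (0 : E) 1, c ≤ ν y := by
    rcases (Metric.sphere (0 : E) 1).eq_empty_or_nonempty with he | hne
    · exact ⟨1, one_pos, by simp [he]⟩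
    · obtain ⟨w, hw, hmin⟩ := (isCompact_sphere (0 : E) 1).exists_isMinOn hne
        (seminorm_continuous ν).continuousOn
      refine ⟨ν w, (apply_nonneg ν w).lt_of_ne fun h0 => ?_, fun y hy => hmin hy⟩
      rw [hν w h0.symm] at hw
      simp at hw
  refine ⟨c * (r / 2), by positivity, fun y hy => hrs ?_⟩
  rw [Metric.mem_ball, dist_eq_norm]
  rcases eq_or_ne (y - x) 0 with h0 | h0
  · simpa [h0] using hr
  · have h1 := hcν (‖y - x‖⁻¹ • (y - x)) (by simp [norm_smul, h0])
    rw [map_smul_eq_mul, norm_inv, norm_norm, ← div_eq_inv_mul,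
      le_div_iff₀ (norm_pos_iff.2 h0)] at h1
    have := le_of_mul_le_mul_left (h1.trans hy) hc
    linarith

/-- The difference quotients along `u` at `x` and along `v` at `y` have the same `ν`-size, since
both depend only on `φ (|t| * ν u)`. -/
theorem seminorm_fderiv_eq {U : Set E} (hU : IsOpen U) {h' : E → E →L[ℝ] E}
    (hd : ∀ w ∈ U, HasFDerivAt h (h' w) w)
    (hh : ∀ x ∈ U, ∀ y ∈ U, ν (h x - h y) = φ (ν (x - y))) {x y u v : E}
    (hx : x ∈ U) (hy : y ∈ U) (huv : ν u = ν v) : ν (h' x u) = ν (h' y v) := by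
  have key : ∀ x ∈ U, ∀ u, Tendsto (fun t : ℝ => ν (t⁻¹ • (h (x + t • u) - h x))) (𝓝[≠] 0)
      (𝓝 (ν (h' x u))) := fun x hx u =>
    ((seminorm_continuous ν).tendsto _).comp ((hd x hx).hasLineDerivAt u).tendsto_slope_zero
  have hmem : ∀ x ∈ U, ∀ u, ∀ᶠ t : ℝ in 𝓝[≠] 0, x + t • u ∈ U := fun x hx u => by
    have : Tendsto (fun t : ℝ => x + t • u) (𝓝 0) (𝓝 x) := by
      have : Continuous fun t : ℝ => x + t • u := by fun_prop
      simpa using this.tendsto 0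
    exact (this.eventually (hU.mem_nhds hx)).filter_mono nhdsWithin_le_nhds
  refine tendsto_nhds_unique (key x hx u) ((key y hy v).congr' ?_)
  filter_upwards [hmem x hx u, hmem y hy v] with t h1 h2
  rw [map_smul_eq_mul, map_smul_eq_mul, hh _ h1 _ hx, hh _ h2 _ hy]
  simp [map_smul_eq_mul, huv]

theorem fderiv_injective_of_seminorm_map_sub {U : Set E} (hU : IsOpen U) (hUc : Convex ℝ U)
    {h' : E → E →L[ℝ] E} (hν : ∀ x, ν x = 0 → x = 0)
    (hd : ∀ w ∈ U, HasFDerivAt h (h' w) w) (hinj : InjOn h U)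
    (hh : ∀ x ∈ U, ∀ y ∈ U, ν (h x - h y) = φ (ν (x - y))) {x : E} (hx : x ∈ U) :
    Function.Injective (h' x) := by
  rw [injective_iff_map_eq_zero]
  intro v hv
  by_contra hv0
  -- A direction killed at one point can be rescaled to any `ν`-length, so every derivative kills
  -- every direction. Then `h` is constant on `U`, against injectivity.
  have hzero : ∀ y ∈ U, h' y = 0 := by
    intro y hy
    ext u
    refine hν _ ?_
    have hvpos : ν v ≠ 0 := fun h0 => hv0 (hν v h0)
    rw [seminorm_fderiv_eq hU hd hh hy hx (u := u) (v := (ν u / ν v) • v) ?_, map_smul, hv]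
    · simp
    · rw [map_smul_eq_mul, Real.norm_of_nonneg (by positivity), div_mul_cancel₀ _ hvpos]
  have hcont : Tendsto (fun t : ℝ => x + t • v) (𝓝[≠] 0) (𝓝 x) := by
    have : Continuous fun t : ℝ => x + t • v := by fun_prop
    simpa using (this.tendsto 0).mono_left (nhdsWithin_le_nhds (s := {0}ᶜ))
  obtain ⟨t, htU, ht0⟩ := ((hcont.eventually (hU.mem_nhds hx)).and self_mem_nhdsWithin).exists
  have heq := hU.is_const_of_fderiv_eq_zero hUc.isPreconnected
    (fun y hy => (hd y hy).differentiableAt.differentiableWithinAt)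
    (fun y hy => by rw [(hd y hy).fderiv, hzero y hy]; rfl) htU hx
  have := hinj htU hx heq
  simp [hv0] at this
  exact ht0 this

omit [FiniteDimensional ℝ E] in
/-- A map which is differentiable at `x` and preserves midpoints between `x` and nearby points is
affine near `x`. -/
theorem eq_add_fderiv_of_map_half {x : E} {h' : E →L[ℝ] E} (hd : HasFDerivAt h h' x) {ρ : ℝ}
    (hmid : ∀ v, ‖v‖ < ρ → h (x + (2 : ℝ)⁻¹ • v) - h x = (2 : ℝ)⁻¹ • (h (x + v) - h x)) {v : E}
    (hv : ‖v‖ < ρ) : h (x + v) = h x + h' v := by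
  -- Repeated halving makes the difference quotient constant along `t = 2⁻¹ ^ n`, so it equals its
  -- limit, the derivative.
  have hpow : ∀ n : ℕ, ((2 : ℝ)⁻¹ ^ n)⁻¹ • (h (x + (2 : ℝ)⁻¹ ^ n • v) - h x) = h (x + v) - h x := by
    intro n
    induction n with
    | zero => simp
    | succ n ih =>
      rw [← ih, pow_succ', mul_smul, hmid, smul_smul]
      · congr 1
        field_simp
      · rw [norm_smul, norm_pow, norm_inv, Real.norm_two]
        exact (mul_le_of_le_one_left (norm_nonneg v)
          (pow_le_one₀ (by norm_num) (by norm_num))).trans_lt hv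
  have hlim : Tendsto (fun n : ℕ => (2 : ℝ)⁻¹ ^ n) atTop (𝓝[≠] 0) :=
    tendsto_nhdsWithin_iff.2 ⟨tendsto_pow_atTop_nhds_zero_of_lt_one (by norm_num) (by norm_num),
      Eventually.of_forall fun n => by simp⟩
  have h1 := (hd.hasLineDerivAt v).tendsto_slope_zero.comp hlim
  have h2 := tendsto_nhds_unique (h1.congr hpow) tendsto_const_nhds
  rw [h2]; abel

theorem eventually_eq_add_fderiv_of_seminorm_map_sub {U : Set E} (hU : IsOpen U) (hUc : Convex ℝ U)
    {h' : E → E →L[ℝ] E} (hν : ∀ x, ν x = 0 → x = 0) (hφ : StrictMonoOn φ (Ici 0)) (hφ0 : φ 0 = 0)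
    (hφc : Continuous φ) (hd : ∀ w ∈ U, HasFDerivAt h (h' w) w)
    (hh : ∀ x ∈ U, ∀ y ∈ U, ν (h x - h y) = φ (ν (x - y))) {x : E} (hx : x ∈ U) :
    Function.Injective (h' x) ∧ ∀ᶠ y in 𝓝 x, h y = h x + h' x (y - x) := by
  have hinj : InjOn h U := by
    intro x hx y hy hxy
    have := hh x hx y hy
    rw [hxy, sub_self, map_zero, ← hφ0] at this
    exact sub_eq_zero.1 (hν _ (hφ.injOn (mem_Ici.2 le_rfl) (apply_nonneg ν _) this).symm)
  have hdinj : ∀ w ∈ U, Function.Injective (h' w) := fun w hw =>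
    fderiv_injective_of_seminorm_map_sub hU hUc hν hd hinj hh hw
  refine ⟨hdinj x hx, ?_⟩
  have hopen : h '' U ∈ 𝓝 (h x) := image_mem_nhds_of_injOn_of_hasFDerivAt hU hd
    (fun w hw => LinearMap.injective_iff_surjective (f := (h' w : E →ₗ[ℝ] E)).1 (hdinj w hw))
    hinj hx
  obtain ⟨ε, hε, hεU⟩ := exists_seminorm_ball_subset hν (hU.mem_nhds hx)
  obtain ⟨ε', hε', hεV⟩ := exists_seminorm_ball_subset hν hopen
  have hev : ∀ᶠ r in 𝓝[>] (0 : ℝ), φ r < ε' ∧ r < ε :=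
    ((hφc.tendsto' 0 0 hφ0 |>.eventually_lt_const hε').and
      (eventually_lt_nhds hε)).filter_mono nhdsWithin_le_nhds
  obtain ⟨r, ⟨hr1, hr2⟩, hr0⟩ := (hev.and self_mem_nhdsWithin).exists
  obtain ⟨ρ, hρ, hρν⟩ := Metric.eventually_nhds_iff_ball.1
    (((seminorm_continuous ν).tendsto' 0 0 (map_zero ν)).eventually_lt_const hr0)
  have hmid : ∀ v, ‖v‖ < ρ → h (x + (2 : ℝ)⁻¹ • v) - h x = (2 : ℝ)⁻¹ • (h (x + v) - h x) := by
    intro v hv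
    have := map_midpoint_of_seminorm_map_sub hν hφ hφ0 hh (a := x) (b := x + v) (r := r)
      (by simpa using (hρν v (by simpa using hv)).le) (fun y hy => hεU y (hy.trans hr2.le))
      (fun y hy => hεV y (hy.trans hr1.le))
    rw [midpoint_eq_smul_add, midpoint_eq_smul_add, invOf_eq_inv] at this
    rw [show x + (2 : ℝ)⁻¹ • v = (2 : ℝ)⁻¹ • (x + (x + v)) by module, this]
    module
  filter_upwards [Metric.ball_mem_nhds x hρ] with y hy
  have := eq_add_fderiv_of_map_half (hd x hx) hmid (v := y - x) (by
    rwa [Metric.mem_ball, dist_eq_norm] at hy)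
  rwa [add_sub_cancel] at this

/-- A differentiable self-map of a convex body which transforms distances by a gauge is affine. -/
theorem exists_affineEquiv_of_seminorm_map_sub {Z : Set E} (hZ : Convex ℝ Z)
    (hne : (interior Z).Nonempty) (hν : ∀ x, ν x = 0 → x = 0) (hφ : StrictMonoOn φ (Ici 0))
    (hφ0 : φ 0 = 0) (hφc : Continuous φ) (hd : DifferentiableOn ℝ h Z)
    (hh : ∀ x ∈ Z, ∀ y ∈ Z, ν (h x - h y) = φ (ν (x - y))) :
    ∃ A : E ≃ᵃ[ℝ] E, EqOn h A Z := by
  have hU : IsOpen (interior Z) := isOpen_interior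
  have hUc : Convex ℝ (interior Z) := hZ.interior
  have hdU : ∀ w ∈ interior Z, HasFDerivAt h (fderiv ℝ h w) w := fun w hw =>
    ((hd w (interior_subset hw)).differentiableAt (mem_interior_iff_mem_nhds.1 hw)).hasFDerivAt
  have hhU : ∀ x ∈ interior Z, ∀ y ∈ interior Z, ν (h x - h y) = φ (ν (x - y)) := fun x hx y hy =>
    hh x (interior_subset hx) y (interior_subset hy)
  have hloc := fun x (hx : x ∈ interior Z) =>
    eventually_eq_add_fderiv_of_seminorm_map_sub hU hUc hν hφ hφ0 hφc hdU hhU hx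
  -- Local affinity makes `fderiv ℝ h` locally constant, hence constant on the connected interior.
  have hfder : ∀ x ∈ interior Z, HasFDerivAt (fderiv ℝ h) (0 : E →L[ℝ] E →L[ℝ] E) x := by
    intro x hx
    refine (hasFDerivAt_const (fderiv ℝ h x) x).congr_of_eventuallyEq ?_
    filter_upwards [(hloc x hx).2.eventually_nhds] with y hy
    have : HasFDerivAt (fun y => h x + fderiv ℝ h x (y - x)) (fderiv ℝ h x) y :=
      (((fderiv ℝ h x).hasFDerivAt).comp y ((hasFDerivAt_id y).sub_const x)).const_add _
    exact (this.congr_of_eventuallyEq hy).fderiv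
  obtain ⟨x₀, hx₀⟩ := hne
  have hconst : ∀ x ∈ interior Z, fderiv ℝ h x = fderiv ℝ h x₀ := fun x hx =>
    hU.is_const_of_fderiv_eq_zero hUc.isPreconnected
      (fun y hy => (hfder y hy).differentiableAt.differentiableWithinAt)
      (fun y hy => (hfder y hy).fderiv) hx hx₀
  let e : E ≃ₗ[ℝ] E := LinearEquiv.ofInjectiveEndo (fderiv ℝ h x₀ : E →ₗ[ℝ] E) (hloc x₀ hx₀).1
  have he : ∀ v, e v = fderiv ℝ h x₀ v := fun v => rfl
  refine ⟨e.toAffineEquiv.trans (AffineEquiv.constVAdd ℝ E (h x₀ - fderiv ℝ h x₀ x₀)), ?_⟩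
  have hA : ∀ y, (e.toAffineEquiv.trans (AffineEquiv.constVAdd ℝ E (h x₀ - fderiv ℝ h x₀ x₀))) y
      = h x₀ - fderiv ℝ h x₀ x₀ + fderiv ℝ h x₀ y := fun y => rfl
  have hAd : ∀ y, HasFDerivAt (fun y => h x₀ - fderiv ℝ h x₀ x₀ + fderiv ℝ h x₀ y)
      (fderiv ℝ h x₀) y := fun y => ((fderiv ℝ h x₀).hasFDerivAt).const_add _
  have hEq : EqOn h (fun y => h x₀ - fderiv ℝ h x₀ x₀ + fderiv ℝ h x₀ y) (interior Z) :=
    hU.eqOn_of_fderiv_eq hUc.isPreconnected (hd.mono interior_subset)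
      (fun y _ => (hAd y).differentiableAt.differentiableWithinAt)
      (fun y hy => by rw [hconst y hy, (hAd y).fderiv]) hx₀ (by simp)
  have := hEq.of_subset_closure hd.continuousOn
    (fun y _ => (hAd y).continuousAt.continuousWithinAt) interior_subset
    (by rw [hZ.closure_interior_eq_closure_of_nonempty_interior ⟨x₀, hx₀⟩]; exact subset_closure)
  exact fun y hy => (this hy).trans (hA y).symm

end Geometry

/-! ### Gibbs' inequality -/

/-- Gibbs' inequality with its equality case, for two families of positive continuous densities. -/
theorem eqOn_of_setAverage_crossEntropy_le {E : Type*} [NormedAddCommGroup E]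
    [SecondCountableTopology E] [MeasurableSpace E] [BorelSpace E] {μ : Measure E}
    [μ.IsOpenPosMeasure] [IsFiniteMeasureOnCompacts μ] [SFinite μ] {Z : Set E} (hZ : IsCompact Z)
    (hZi : Z ⊆ closure (interior Z)) (hμ : μ.real Z ≠ 0)
    {P Q : E × E → ℝ} (hP : ContinuousOn P (Z ×ˢ Z)) (hQ : ContinuousOn Q (Z ×ˢ Z))
    (hP0 : ∀ a ∈ Z ×ˢ Z, 0 < P a) (hQ0 : ∀ a ∈ Z ×ˢ Z, 0 < Q a)
    (hPQ : ∀ z ∈ Z, ∫ z' in Z, P (z, z') ∂μ = ∫ z' in Z, Q (z, z') ∂μ)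
    (hle : ⨍ z in Z, ∫ z' in Z, P (z, z') * (-log (Q (z, z'))) ∂μ ∂μ ≤
      ⨍ z in Z, ∫ z' in Z, P (z, z') * (-log (P (z, z'))) ∂μ ∂μ) :
    EqOn P Q (Z ×ˢ Z) := by
  have hZZ : IsCompact (Z ×ˢ Z) := hZ.prod hZ
  have hlogP : ContinuousOn (fun a => P a * (-log (P a))) (Z ×ˢ Z) :=
    hP.mul (hP.log fun a ha => (hP0 a ha).ne').neg
  have hlogQ : ContinuousOn (fun a => P a * (-log (Q a))) (Z ×ˢ Z) :=
    hP.mul (hQ.log fun a ha => (hQ0 a ha).ne').neg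
  have hint : ∀ {F : E × E → ℝ}, ContinuousOn F (Z ×ˢ Z) →
      Integrable F ((μ.restrict Z).prod (μ.restrict Z)) := fun {F} hF => by
    rw [Measure.prod_restrict]
    exact hF.integrableOn_compact hZZ
  have hslice : ∀ {F : E × E → ℝ}, ContinuousOn F (Z ×ˢ Z) → ∀ z ∈ Z,
      Integrable (fun z' => F (z, z')) (μ.restrict Z) := fun {F} hF z hz =>
    (hF.comp (by fun_prop : ContinuousOn (fun z' => (z, z')) Z)
      fun z' hz' => ⟨hz, hz'⟩).integrableOn_compact hZ
  -- The added `- P + Q` integrates to zero on each slice and turns the log-ratio integrand into the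
  -- pointwise nonnegative `Q * klFun (P / Q)`.
  let D : E × E → ℝ := fun a => P a * (-log (Q a)) - P a * (-log (P a)) - P a + Q a
  have hDkl : ∀ a ∈ Z ×ˢ Z, D a = Q a * InformationTheory.klFun (P a / Q a) := fun a ha => by
    have h1 := (hP0 a ha).ne'
    have h2 := (hQ0 a ha).ne'
    simp only [D, InformationTheory.klFun_apply, log_div h1 h2]
    field_simp
    ring
  have hD : ContinuousOn D (Z ×ˢ Z) := ((hlogQ.sub hlogP).sub hP).add hQ
  have hD0 : ∀ a ∈ Z ×ˢ Z, 0 ≤ D a := fun a ha => by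
    rw [hDkl a ha]
    exact mul_nonneg (hQ0 a ha).le
      (InformationTheory.klFun_nonneg (div_pos (hP0 a ha) (hQ0 a ha)).le)
  rw [setAverage_eq, setAverage_eq, smul_eq_mul, smul_eq_mul] at hle
  replace hle := le_of_mul_le_mul_left hle
    (inv_pos.2 (measureReal_nonneg.lt_of_ne hμ.symm))
  have hDint : ∫ a in Z ×ˢ Z, D a ∂(μ.prod μ) ≤ 0 := by
    rw [← Measure.prod_restrict, integral_prod _ (hint hD)]
    have : ∫ z in Z, ∫ z' in Z, D (z, z') ∂μ ∂μ = ∫ z in Z, ((∫ z' in Z, P (z, z') *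
        (-log (Q (z, z'))) ∂μ) - ∫ z' in Z, P (z, z') * (-log (P (z, z'))) ∂μ) ∂μ := by
      refine setIntegral_congr_fun hZ.isClosed.measurableSet fun z hz => ?_
      simp only [D]
      have h1 : Integrable (fun z' => P (z, z') * (-log (Q (z, z'))) -
          P (z, z') * (-log (P (z, z')))) (μ.restrict Z) :=
        (hslice hlogQ z hz).sub (hslice hlogP z hz)
      have h2 : Integrable (fun z' => P (z, z') * (-log (Q (z, z'))) -
          P (z, z') * (-log (P (z, z'))) - P (z, z')) (μ.restrict Z) := h1.sub (hslice hP z hz)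
      rw [integral_add h2 (hslice hQ z hz), integral_sub h1 (hslice hP z hz), integral_sub (hslice hlogQ z hz) (hslice hlogP z hz), hPQ z hz]
      ring
    rw [this, integral_sub (hint hlogQ).integral_prod_left (hint hlogP).integral_prod_left]
    linarith
  have hZZm : MeasurableSet (Z ×ˢ Z) := hZZ.isClosed.measurableSet
  have hae : D =ᵐ[(μ.prod μ).restrict (Z ×ˢ Z)] 0 := by
    rw [← setIntegral_eq_zero_iff_of_nonneg_ae
      ((ae_restrict_iff' hZZm).2 (Eventually.of_forall hD0)) (hD.integrableOn_compact hZZ)]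
    exact le_antisymm hDint (setIntegral_nonneg hZZm hD0)
  -- Almost everywhere becomes everywhere: `D` is continuous and `Z ×ˢ Z` lies in the closure of its
  -- interior.
  have hzero := Measure.eqOn_of_ae_eq hae hD continuousOn_const (by
    rw [interior_prod_eq, closure_prod_eq]
    exact prod_mono hZi hZi)
  intro a ha
  have h1 := hzero ha
  rw [hDkl a ha, Pi.zero_apply, mul_eq_zero, or_iff_right (hQ0 a ha).ne',
    InformationTheory.klFun_eq_zero_iff (div_pos (hP0 a ha) (hQ0 a ha)).le,
    div_eq_one_iff_eq (hQ0 a ha).ne'] at h1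
  exact h1

/-! ### The densities and their matching -/

section Density

variable {N : ℕ} {Z : Set (EuclideanSpace ℝ (Fin N))}
  {δ : EuclideanSpace ℝ (Fin N) → EuclideanSpace ℝ (Fin N) → ℝ}
  {h : EuclideanSpace ℝ (Fin N) → EuclideanSpace ℝ (Fin N)} {lam tau : ℝ}

theorem trueDensity_eq_modelDensity (hδ : ∀ x y, δ x y = δ y x) (z' z : EuclideanSpace ℝ (Fin N)) :
    trueDensity Z δ lam z' z = modelDensity Z δ lam⁻¹ id z' z := by
  simp [trueDensity, modelDensity, hδ z, mul_comm]

variable (hZ : IsCompact Z) (hδ : Continuous (Function.uncurry δ)) (hδ0 : ∀ x y, 0 ≤ δ x y)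
  (htau : 0 < tau) (hh : ContinuousOn h Z)
include hZ hδ hh

theorem integrableOn_exp_neg_div {z : EuclideanSpace ℝ (Fin N)} :
    IntegrableOn (fun w => exp (-(δ (h w) (h z) / tau))) Z := by
  refine ContinuousOn.integrableOn_compact hZ (ContinuousOn.rexp ?_)
  have : Continuous fun w => -(δ w (h z) / tau) :=
    ((hδ.comp (by fun_prop : Continuous fun w => (w, h z))).div_const _).neg
  exact this.comp_continuousOn hh

theorem integral_exp_neg_div_pos (hμ : volume Z ≠ 0) {z : EuclideanSpace ℝ (Fin N)} :
    0 < ∫ w in Z, exp (-(δ (h w) (h z) / tau)) := by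
  have : NeZero (volume.restrict Z) := ⟨by simpa using hμ⟩
  exact integral_exp_pos (integrableOn_exp_neg_div hZ hδ hh)

theorem modelDensity_pos (hμ : volume Z ≠ 0) {z' z : EuclideanSpace ℝ (Fin N)} :
    0 < modelDensity Z δ tau h z' z :=
  mul_pos (inv_pos.2 (integral_exp_neg_div_pos hZ hδ hh hμ)) (exp_pos _)

theorem integral_modelDensity (hμ : volume Z ≠ 0) {z : EuclideanSpace ℝ (Fin N)} :
    ∫ z' in Z, modelDensity Z δ tau h z' z = 1 := by
  simp only [modelDensity]
  rw [integral_const_mul, inv_mul_cancel₀ (integral_exp_neg_div_pos hZ hδ hh hμ).ne']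

include hδ0 htau

theorem continuousOn_modelDensity (hμ : volume Z ≠ 0) :
    ContinuousOn (fun a : EuclideanSpace ℝ (Fin N) × EuclideanSpace ℝ (Fin N) =>
      modelDensity Z δ tau h a.2 a.1) (Z ×ˢ Z) := by
  have hC : ContinuousOn (fun z => ∫ w in Z, exp (-(δ (h w) (h z) / tau))) Z := by
    refine continuousOn_of_dominated (bound := fun _ => 1)
      (fun z _ => (integrableOn_exp_neg_div hZ hδ hh).aestronglyMeasurable)
      (fun z _ => Eventually.of_forall fun w => ?_) ?_ (Eventually.of_forall fun w => ?_)
    · rw [Real.norm_of_nonneg (exp_pos _).le, exp_le_one_iff, neg_nonpos]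
      exact div_nonneg (hδ0 _ _) htau.le
    · exact (integrableOn_const hZ.measure_lt_top.ne)
    · have : Continuous fun y => exp (-(δ (h w) y / tau)) :=
        ((hδ.comp (by fun_prop : Continuous fun y => (h w, y))).div_const _).neg.rexp
      exact this.comp_continuousOn hh
  have hE : ContinuousOn (fun a : EuclideanSpace ℝ (Fin N) × EuclideanSpace ℝ (Fin N) =>
      exp (-(δ (h a.2) (h a.1) / tau))) (Z ×ˢ Z) := by
    have : Continuous fun b : EuclideanSpace ℝ (Fin N) × EuclideanSpace ℝ (Fin N) =>
        exp (-(δ b.1 b.2 / tau)) := (hδ.div_const _).neg.rexp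
    exact this.comp_continuousOn
      ((hh.comp continuousOn_snd fun a ha => ha.2).prodMk
        (hh.comp continuousOn_fst fun a ha => ha.1))
  exact ((hC.comp continuousOn_fst fun a ha => ha.1).inv₀
    fun a _ => (integral_exp_neg_div_pos hZ hδ hh hμ).ne').mul hE

/-- An encoder whose cross-entropy does not exceed the entropy of the ground truth matches it. -/
theorem modelDensity_eq_of_crossEntropy_le (hZi : Z ⊆ closure (interior Z)) (hμ : volume Z ≠ 0)
    (hsymm : ∀ x y, δ x y = δ y x) (hlam : 0 < lam)
    (hle : crossEntropy Z δ lam tau h ≤ crossEntropy Z δ lam lam⁻¹ id) :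
    ∀ z ∈ Z, ∀ z' ∈ Z, modelDensity Z δ tau h z' z = modelDensity Z δ lam⁻¹ id z' z := by
  have hlam' := inv_pos.2 hlam
  simp only [crossEntropy, trueDensity_eq_modelDensity hsymm] at hle
  have := eqOn_of_setAverage_crossEntropy_le (μ := volume) hZ hZi
    (ENNReal.toReal_ne_zero.2 ⟨hμ, hZ.measure_lt_top.ne⟩)
    (continuousOn_modelDensity hZ hδ hδ0 hlam' continuousOn_id hμ)
    (continuousOn_modelDensity hZ hδ hδ0 htau hh hμ)
    (fun a _ => modelDensity_pos hZ hδ continuousOn_id hμ)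
    (fun a _ => modelDensity_pos hZ hδ hh hμ)
    (fun z _ => by
      simp only
      rw [integral_modelDensity hZ hδ continuousOn_id hμ, integral_modelDensity hZ hδ hh hμ]) hle
  exact fun z hz z' hz' => (this (x := (z, z')) ⟨hz, hz'⟩).symm

omit hδ0 htau hh in
/-- Matching densities differ by a rescaling of the distance. -/
theorem dist_eq_of_modelDensity_eq (hμ : volume Z ≠ 0) (htau : tau ≠ 0)
    (hδs : ∀ x, δ x x = 0)
    (heq : ∀ z ∈ Z, ∀ z' ∈ Z, modelDensity Z δ tau h z' z = modelDensity Z δ lam⁻¹ id z' z)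
    {x y : EuclideanSpace ℝ (Fin N)} (hx : x ∈ Z) (hy : y ∈ Z) :
    δ (h x) (h y) = lam * tau * δ x y := by
  -- On the diagonal both exponentials are 1, so the normalising constants agree and the exponents
  -- can be compared.
  have h1 := heq y hy y hy
  have h2 := heq y hy x hx
  simp only [modelDensity, hδs, zero_div, neg_zero, exp_zero, mul_one] at h1 h2
  rw [h1] at h2
  have hpos := inv_pos.2 (integral_exp_neg_div_pos (tau := lam⁻¹) (z := y) hZ hδ
    continuousOn_id hμ)
  have h3 := exp_injective (mul_left_cancel₀ hpos.ne' h2)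
  simp only [id] at h3
  field_simp at h3
  linarith

end Density

/-! ### Smooth approximate inverses and stability of the cross-entropy -/

/-- The inverse of a continuous injection of a compact convex set is uniformly approximated by
globally smooth maps into that set. -/
theorem exists_differentiable_approx_inverse {E F : Type*} [NormedAddCommGroup E] [NormedSpace ℝ E]
    [NormedAddCommGroup F] [NormedSpace ℝ F] [FiniteDimensional ℝ F] {Z : Set E}
    (hZ : IsCompact Z) (hZc : Convex ℝ Z) (hne : Z.Nonempty) {g : E → F} (hg : ContinuousOn g Z)
    (hinj : InjOn g Z) {η : ℝ} (hη : 0 < η) :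
    ∃ f : F → E, Differentiable ℝ f ∧ (∀ x, f x ∈ Z) ∧ ∀ z ∈ Z, dist (f (g z)) z < η := by
  -- Admissible values at `x`: points of `Z` that are `η`-close to every preimage of `x`. Convexity
  -- lets a smooth partition of unity glue local constants.
  let t : F → Set E := fun x => Z ∩ ⋂ z ∈ {z ∈ Z | g z = x}, Metric.ball z η
  have ht : ∀ x, Convex ℝ (t x) := fun x =>
    hZc.inter (convex_iInter₂ fun z _ => convex_ball z η)
  have hloc : ∀ x, ∃ c, ∀ᶠ y in 𝓝 x, c ∈ t y := by
    intro x
    obtain ⟨c, hc, hcx⟩ : ∃ c ∈ Z, x ∉ g '' (Z \ Metric.ball c η) := by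
      by_cases hx : x ∈ g '' Z
      · obtain ⟨c, hc, rfl⟩ := hx
        refine ⟨c, hc, ?_⟩
        rintro ⟨z, ⟨hz, hzc⟩, hzg⟩
        rw [hinj hz hc hzg] at hzc
        exact hzc (Metric.mem_ball_self hη)
      · exact ⟨hne.some, hne.some_mem, fun hx' => hx (image_mono sdiff_subset hx')⟩
    -- Off this compact image, all preimages of `y` lie within `η` of `c`, so the constant `c` is
    -- admissible near `x`.
    have hclosed : IsClosed (g '' (Z \ Metric.ball c η)) :=
      ((hZ.diff Metric.isOpen_ball).image_of_continuousOn (hg.mono sdiff_subset)).isClosed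
    refine ⟨c, ?_⟩
    filter_upwards [hclosed.isOpen_compl.mem_nhds hcx] with y hy
    refine ⟨hc, mem_iInter₂.2 fun z hz => ?_⟩
    by_contra hcz
    exact hy ⟨z, ⟨hz.1, fun h => hcz (Metric.mem_ball_comm.1 h)⟩, hz.2⟩
  obtain ⟨f, hf⟩ := exists_contMDiffMap_forall_mem_convex_of_local_const (n := 1)
    (modelWithCornersSelf ℝ F) ht hloc
  refine ⟨f, f.contMDiff.contDiff.differentiable one_ne_zero, fun x => (hf x).1, fun z hz => ?_⟩
  exact mem_iInter₂.1 (hf (g z)).2 z ⟨hz, rfl⟩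

section Density

variable {N : ℕ} {Z : Set (EuclideanSpace ℝ (Fin N))}
  {δ : EuclideanSpace ℝ (Fin N) → EuclideanSpace ℝ (Fin N) → ℝ}
  {h k : EuclideanSpace ℝ (Fin N) → EuclideanSpace ℝ (Fin N)} {lam tau : ℝ}

/-- The exponent and the logarithm of the normalising constant each change by at most `ε / tau`,
whence the factor 2. -/
theorem neg_log_modelDensity_le (hZ : IsCompact Z) (hδ : Continuous (Function.uncurry δ))
    (htau : 0 < tau) (hh : ContinuousOn h Z) (hk : ContinuousOn k Z) (hμ : volume Z ≠ 0) {ε : ℝ}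
    (hε : ∀ x ∈ Z, ∀ y ∈ Z, |δ (h x) (h y) - δ (k x) (k y)| ≤ ε)
    {z z' : EuclideanSpace ℝ (Fin N)} (hz : z ∈ Z) (hz' : z' ∈ Z) :
    -log (modelDensity Z δ tau h z' z) ≤ -log (modelDensity Z δ tau k z' z) + 2 * ε / tau := by
  have hCh := integral_exp_neg_div_pos (tau := tau) (z := z) hZ hδ hh hμ
  have hCk := integral_exp_neg_div_pos (tau := tau) (z := z) hZ hδ hk hμ
  have hC : ∫ w in Z, exp (-(δ (h w) (h z) / tau)) ≤
      exp (ε / tau) * ∫ w in Z, exp (-(δ (k w) (k z) / tau)) := by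
    rw [← integral_const_mul]
    refine setIntegral_mono_on (integrableOn_exp_neg_div hZ hδ hh)
      ((integrableOn_exp_neg_div hZ hδ hk).const_mul _) hZ.isClosed.measurableSet fun w hw => ?_
    rw [← exp_add, exp_le_exp, ← sub_eq_add_neg, ← sub_div, ← neg_div]
    gcongr
    linarith [(abs_le.1 (hε w hw z hz)).1]
  have hlogC := log_le_log hCh hC
  rw [log_mul (exp_pos _).ne' hCk.ne', log_exp] at hlogC
  have hd : δ (h z') (h z) / tau ≤ δ (k z') (k z) / tau + ε / tau := by
    rw [← add_div]
    gcongr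
    linarith [(abs_le.1 (hε z' hz' z hz)).2]
  simp only [modelDensity]
  rw [log_mul (inv_pos.2 hCh).ne' (exp_pos _).ne', log_mul (inv_pos.2 hCk).ne' (exp_pos _).ne',
    log_inv, log_inv, log_exp, log_exp, two_mul, add_div]
  linarith

theorem crossEntropy_le_add (hZ : IsCompact Z) (hδ : Continuous (Function.uncurry δ))
    (hδ0 : ∀ x y, 0 ≤ δ x y) (hsymm : ∀ x y, δ x y = δ y x) (hlam : 0 < lam)
    (htau : 0 < tau) (hh : ContinuousOn h Z) (hk : ContinuousOn k Z) (hμ : volume Z ≠ 0) {ε : ℝ}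
    (hε : ∀ x ∈ Z, ∀ y ∈ Z, |δ (h x) (h y) - δ (k x) (k y)| ≤ ε) :
    crossEntropy Z δ lam tau h ≤ crossEntropy Z δ lam tau k + 2 * ε / tau := by
  have hZm : MeasurableSet Z := hZ.isClosed.measurableSet
  have hcont : ∀ {h : EuclideanSpace ℝ (Fin N) → EuclideanSpace ℝ (Fin N)}, ContinuousOn h Z →
      ContinuousOn (fun a : EuclideanSpace ℝ (Fin N) × EuclideanSpace ℝ (Fin N) =>
        modelDensity Z δ lam⁻¹ id a.2 a.1 * (-log (modelDensity Z δ tau h a.2 a.1))) (Z ×ˢ Z) :=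
    fun {h} hh => (continuousOn_modelDensity hZ hδ hδ0 (inv_pos.2 hlam) continuousOn_id hμ).mul
      ((continuousOn_modelDensity hZ hδ hδ0 htau hh hμ).log
        fun a _ => (modelDensity_pos hZ hδ hh hμ).ne').neg
  have houter : ∀ {h : EuclideanSpace ℝ (Fin N) → EuclideanSpace ℝ (Fin N)}, ContinuousOn h Z →
      IntegrableOn (fun z => ∫ z' in Z,
        modelDensity Z δ lam⁻¹ id z' z * (-log (modelDensity Z δ tau h z' z))) Z := fun {h} hh => by
    have : Integrable (fun a : EuclideanSpace ℝ (Fin N) × EuclideanSpace ℝ (Fin N) =>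
        modelDensity Z δ lam⁻¹ id a.2 a.1 * (-log (modelDensity Z δ tau h a.2 a.1)))
        ((volume.restrict Z).prod (volume.restrict Z)) := by
      rw [Measure.prod_restrict]
      exact (hcont hh).integrableOn_compact (hZ.prod hZ)
    exact this.integral_prod_left
  have hinner : ∀ {h : EuclideanSpace ℝ (Fin N) → EuclideanSpace ℝ (Fin N)}, ContinuousOn h Z →
      ∀ z ∈ Z, IntegrableOn (fun z' =>
        modelDensity Z δ lam⁻¹ id z' z * (-log (modelDensity Z δ tau h z' z))) Z :=
    fun {h} hh z hz => ((hcont hh).comp (by fun_prop : ContinuousOn (fun z' => (z, z')) Z)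
      fun z' hz' => ⟨hz, hz'⟩).integrableOn_compact hZ
  have hp : ∀ z ∈ Z, IntegrableOn (fun z' => modelDensity Z δ lam⁻¹ id z' z) Z := fun z hz =>
    ((continuousOn_modelDensity hZ hδ hδ0 (inv_pos.2 hlam) continuousOn_id hμ).comp
      (by fun_prop : ContinuousOn (fun z' => (z, z')) Z)
      fun z' hz' => ⟨hz, hz'⟩).integrableOn_compact hZ
  have hμ' : 0 < volume.real Z := ENNReal.toReal_pos hμ hZ.measure_lt_top.ne
  simp only [crossEntropy, trueDensity_eq_modelDensity hsymm, setAverage_eq, smul_eq_mul]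
  rw [show 2 * ε / tau = (volume.real Z)⁻¹ * ∫ z in Z, 2 * ε / tau by
    rw [setIntegral_const, smul_eq_mul, inv_mul_cancel_left₀ hμ'.ne'], ← mul_add,
    ← integral_add (houter hk) (integrableOn_const hZ.measure_lt_top.ne)]
  refine mul_le_mul_of_nonneg_left ?_ (inv_pos.2 hμ').le
  refine setIntegral_mono_on (houter hh)
    ((houter hk).add (integrableOn_const hZ.measure_lt_top.ne)) hZm fun z hz => ?_
  have hone : ∫ z' in Z, modelDensity Z δ lam⁻¹ id z' z * (2 * ε / tau) = 2 * ε / tau := by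
    rw [integral_mul_const, integral_modelDensity hZ hδ continuousOn_id hμ, one_mul]
  conv_rhs => rw [← hone]
  rw [← integral_add (hinner hk z hz) ((hp z hz).mul_const _)]
  refine setIntegral_mono_on (hinner hh z hz)
    ((hinner hk z hz).add ((hp z hz).mul_const _)) hZm fun z' hz' => ?_
  rw [← mul_add]
  exact mul_le_mul_of_nonneg_left (neg_log_modelDensity_le hZ hδ htau hh hk hμ hε hz hz')
    (modelDensity_pos hZ hδ continuousOn_id hμ).le

end Density

/-! ### The distance `j ∘ ν` -/

section NormDist

variable {N : ℕ} {ν : Seminorm ℝ (EuclideanSpace ℝ (Fin N))} {j : ℝ≥0 ≃ₜ ℝ≥0}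

theorem normDist_nonneg (x y : EuclideanSpace ℝ (Fin N)) : 0 ≤ normDist ν j x y :=
  NNReal.coe_nonneg _

theorem normDist_comm (x y : EuclideanSpace ℝ (Fin N)) : normDist ν j x y = normDist ν j y x := by
  simp [normDist, map_sub_rev ν x]

theorem normDist_self (hj : j 0 = 0) (x : EuclideanSpace ℝ (Fin N)) : normDist ν j x x = 0 := by
  simp [normDist, hj]

theorem continuous_normDist : Continuous (Function.uncurry (normDist ν j)) := by
  have := seminorm_continuous ν
  have hj := j.continuous
  unfold normDist Function.uncurry
  fun_prop

theorem strictMono_of_map_zero (hj : j 0 = 0) : StrictMono j := by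
  refine (j.continuous.strictMono_of_inj j.injective).resolve_right fun hanti => ?_
  have := hanti (zero_lt_one (α := ℝ≥0))
  rw [hj] at this
  exact not_lt_zero this

/-- A differentiable map of a convex body which rescales the distance is affine and invertible. -/
theorem exists_affineEquiv_of_normDist_eq_mul (hν : ∀ x, ν x = 0 → x = 0) (hj : j 0 = 0) {c : ℝ}
    (hc : 0 < c) {Z : Set (EuclideanSpace ℝ (Fin N))} (hZ : Convex ℝ Z)
    (hne : (interior Z).Nonempty) {h : EuclideanSpace ℝ (Fin N) → EuclideanSpace ℝ (Fin N)}
    (hd : DifferentiableOn ℝ h Z)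
    (hh : ∀ x ∈ Z, ∀ y ∈ Z, normDist ν j (h x) (h y) = c * normDist ν j x y) :
    ∃ A : EuclideanSpace ℝ (Fin N) ≃ᵃ[ℝ] EuclideanSpace ℝ (Fin N), EqOn h A Z := by
  have hjm := strictMono_of_map_zero hj
  -- Solves `j (ν (h x - h y)) = c * j (ν (x - y))` for the first seminorm; `toNNReal` extends `φ`
  -- by 0 to negative reals, keeping it continuous.
  let φ : ℝ → ℝ := fun t => j.symm (c.toNNReal * j t.toNNReal)
  have hc' : 0 < c.toNNReal := Real.toNNReal_pos.2 hc
  refine exists_affineEquiv_of_seminorm_map_sub (ν := ν) (φ := φ) hZ hne hν ?_ ?_ ?_ hd ?_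
  · intro s hs t ht hst
    have h1 : s.toNNReal < t.toNNReal := (Real.toNNReal_lt_toNNReal_iff_of_nonneg hs).2 hst
    refine NNReal.coe_lt_coe.2 (hjm.lt_iff_lt.1 ?_)
    rw [j.apply_symm_apply, j.apply_symm_apply]
    exact mul_lt_mul_of_pos_left (hjm h1) hc'
  · simp only [φ, Real.toNNReal_zero, hj, mul_zero]
    rw [NNReal.coe_eq_zero, j.symm_apply_eq, hj]
  · have h1 := j.continuous
    have h2 := j.symm.continuous
    simp only [φ]
    fun_prop
  · intro x hx y hy
    have h1 : j (ν (h x - h y)).toNNReal = c.toNNReal * j (ν (x - y)).toNNReal := by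
      rw [← NNReal.coe_inj, NNReal.coe_mul, Real.coe_toNNReal _ hc.le]
      exact hh x hx y hy
    simp only [φ]
    rw [← h1, j.symm_apply_apply, Real.coe_toNNReal _ (apply_nonneg ν _)]

end NormDist

/-! ### The theorem -/

theorem mainTheorem8 {N K : ℕ}
    (Z : ConvexBody (EuclideanSpace ℝ (Fin N)))
    (hZ : (interior (Z : Set (EuclideanSpace ℝ (Fin N)))).Nonempty)
    (ν : Seminorm ℝ (EuclideanSpace ℝ (Fin N))) (hν : ∀ x, ν x = 0 → x = 0)
    (j : ℝ≥0 ≃ₜ ℝ≥0) (hj : j 0 = 0)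
    (lam tau : ℝ) (hlam : 0 < lam) (htau : 0 < tau)
    (X : Set (EuclideanSpace ℝ (Fin K)))
    (g : EuclideanSpace ℝ (Fin N) → EuclideanSpace ℝ (Fin K))
    (hgX : MapsTo g Z X) (hg_inj : InjOn g Z) (hg_diff : DifferentiableOn ℝ g Z)
    (f : EuclideanSpace ℝ (Fin K) → EuclideanSpace ℝ (Fin N))
    (hf : f ∈ diffEncoders X (Z : Set (EuclideanSpace ℝ (Fin N)))) :
    -- `p` and `q_h` with the same distance and scale; minimality among differentiable encoders
    (lam * tau = 1 →
      IsMinOn (fun f' => crossEntropy Z (normDist ν j) lam tau (f' ∘ g)) (diffEncoders X Z) f →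
      ∃ A : EuclideanSpace ℝ (Fin N) ≃ᵃ[ℝ] EuclideanSpace ℝ (Fin N), EqOn (f ∘ g) A Z) ∧
    -- arbitrary scales; minimality in any hypothesis class in which `q_h` can match `p`
    (∀ F : Set (EuclideanSpace ℝ (Fin K) → EuclideanSpace ℝ (Fin N)),
      F ⊆ encoders X Z → f ∈ F →
      (∃ f₀ ∈ F, ∀ z ∈ Z, ∀ z' ∈ Z,
        modelDensity Z (normDist ν j) tau (f₀ ∘ g) z' z = trueDensity Z (normDist ν j) lam z' z) →
      IsMinOn (fun f' => crossEntropy Z (normDist ν j) lam tau (f' ∘ g)) F f →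
      ∃ A : EuclideanSpace ℝ (Fin N) ≃ᵃ[ℝ] EuclideanSpace ℝ (Fin N), EqOn (f ∘ g) A Z) := by
  have hd : DifferentiableOn ℝ (f ∘ g) Z := hf.2.comp hg_diff hgX
  have hZi : (Z : Set (EuclideanSpace ℝ (Fin N))) ⊆ closure (interior Z) := by
    rw [Z.convex.closure_interior_eq_closure_of_nonempty_interior hZ]
    exact subset_closure
  have hμ : volume (Z : Set (EuclideanSpace ℝ (Fin N))) ≠ 0 :=
    (Measure.measure_pos_of_nonempty_interior volume hZ).ne'
  have hδ : Continuous (Function.uncurry (normDist ν j)) := continuous_normDist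
  have key : crossEntropy Z (normDist ν j) lam tau (f ∘ g) ≤
      crossEntropy Z (normDist ν j) lam lam⁻¹ id →
      ∃ A : EuclideanSpace ℝ (Fin N) ≃ᵃ[ℝ] EuclideanSpace ℝ (Fin N), EqOn (f ∘ g) A Z := by
    intro hle
    have heq := modelDensity_eq_of_crossEntropy_le Z.isCompact hδ normDist_nonneg htau
      hd.continuousOn hZi hμ normDist_comm hlam hle
    exact exists_affineEquiv_of_normDist_eq_mul hν hj (mul_pos hlam htau) Z.convex hZ hd
      fun x hx y hy => dist_eq_of_modelDensity_eq Z.isCompact hδ hμ htau.ne'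
        (normDist_self hj) heq hx hy
  refine ⟨fun hlt hmin => key ?_, fun F _ _ ⟨f₀, hf₀, hq⟩ hmin => key ?_⟩
  · have htl : lam⁻¹ = tau := inv_eq_of_mul_eq_one_right hlt
    rw [htl]
    refine le_of_forall_pos_le_add fun ε hε => ?_
    have huc := (Z.isCompact.prod Z.isCompact).uniformContinuousOn_of_continuous hδ.continuousOn
    -- The tolerance `ε * tau / 2` is chosen so that the loss `2 * (ε * tau / 2) / tau` in
    -- `crossEntropy_le_add` is `ε`.
    obtain ⟨η, hη, hηδ⟩ := Metric.uniformContinuousOn_iff.1 huc (ε * tau / 2) (by positivity)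
    obtain ⟨f', hf'd, hf'Z, hf'g⟩ := exists_differentiable_approx_inverse Z.isCompact Z.convex
      Z.nonempty hg_diff.continuousOn hg_inj hη
    refine (hmin (show f' ∈ diffEncoders X Z from
      ⟨fun x _ => hf'Z x, hf'd.differentiableOn⟩)).trans ?_
    have := crossEntropy_le_add (ε := ε * tau / 2) Z.isCompact hδ normDist_nonneg normDist_comm
      hlam htau (hf'd.continuous.comp_continuousOn hg_diff.continuousOn) continuousOn_id hμ
      (fun x hx y hy => (hηδ (f' (g x), f' (g y)) ⟨hf'Z _, hf'Z _⟩ (x, y) ⟨hx, hy⟩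
        (max_lt (hf'g x hx) (hf'g y hy))).le)
    rwa [mul_div_cancel₀ _ two_ne_zero, mul_div_cancel_right₀ _ htau.ne'] at this
  · refine (hmin hf₀).trans_eq ?_
    have hZm : MeasurableSet (Z : Set (EuclideanSpace ℝ (Fin N))) :=
      Z.isCompact.isClosed.measurableSet
    simp only [crossEntropy, setAverage_eq]
    congr 1
    refine setIntegral_congr_fun hZm fun z hz => setIntegral_congr_fun hZm fun z' hz' => ?_
    rw [hq z hz z' hz', trueDensity_eq_modelDensity normDist_comm]
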